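/- A left adequate monoid is a monoid $M$ with a unary operation $x\mapsto x^+$ such that for all $x,y,z\in M$: $x^+x=x$; $(x^+y^+)^+=x^+y^+=y^+x^+$; $(xy)^+=(xy^+)^+$; if $x^2=x$ then $x=x^+$; and if $xz=yz$ then $xz^+=yz^+$. Let $\mathrm{FLAd}(a)$ be the free left adequate monoid on one generator $a$, in the signature $(2,1,0)$ of multiplication, $^+$ and identity. The length of a word formed from $a$, the identity, multiplication and $^+$ is the number of occurrences of $a$ in it. For $n\ge 0$, let $B(n)$ be the set of elements of $\mathrm{FLAd}(a)$ represented by a word of length at most $n$, and let $S(n)=B(n)\setminus B(n-1)$, where $B(-1)=\emptyset$. Then every $B(n)$ is finite, $|S(n)|=P(n+1)$ for all $n\ge 0$, where $P(m)$ is the number of partitions of the integer $m$, and $\mathrm{FLAd}(a)$ has intermediate growth, that is, both for $f(n)=|S(n)|$ and for $f(n)=|B(n)|$: 1. for every $d\in\mathbb{N}$, $n^d=o(f(n))$ as $n\to\infty$; 2. for every real $c>1$, $f(n)=o(c^n)$ as $n\to\infty$. -/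

import Mathlib

open Asymptotics Filter

/-- A unary monoid: an algebra of signature `(2,1,0)` whose binary operation and constant form
a monoid. No law is imposed on the unary operation `plus`, written `x ↦ x^+` in comments. -/
class UnaryMonoid (M : Type*) extends Monoid M where
  plus : M → M

open UnaryMonoid (plus)

/-- A left adequate monoid: a unary monoid satisfying the defining quasi-identities. -/
class LeftAdequateMonoid (M : Type*) extends UnaryMonoid M where
  plus_mul_self (x : M) : plus x * x = x
  plus_plus_mul_plus (x y : M) : plus (plus x * plus y) = plus x * plus y
  plus_mul_comm (x y : M) : plus x * plus y = plus y * plus x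
  plus_mul (x y : M) : plus (x * y) = plus (x * plus y)
  eq_plus_of_idem (x : M) : x * x = x → x = plus x
  mul_plus_cancel (x y z : M) : x * z = y * z → x * plus z = y * plus z

/-- Morphisms in the signature `(2,1,0)`. -/
structure UnaryMonoidHom (M N : Type*) [UnaryMonoid M] [UnaryMonoid N] extends M →* N where
  map_plus' (x : M) : toFun (plus x) = plus (toFun x)

instance (M N : Type*) [UnaryMonoid M] [UnaryMonoid N] : CoeFun (UnaryMonoidHom M N)
    (fun _ => M → N) := ⟨fun f => f.toFun⟩

/-- The free unary monoid on `X`. Its elements are the finite sequences whose entries are either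
a letter `x ∈ X` or a bracketed element `u^+`, where `u` is again such a sequence. Here
`letter x w` is the sequence `x w` and `bracket u w` is the sequence `u^+ w`. -/
inductive FreeUnaryMonoid (X : Type*) where
  | empty : FreeUnaryMonoid X
  | letter (x : X) (w : FreeUnaryMonoid X) : FreeUnaryMonoid X
  | bracket (u w : FreeUnaryMonoid X) : FreeUnaryMonoid X

namespace FreeUnaryMonoid

variable {X : Type*}

/-- Concatenation. -/
def append : FreeUnaryMonoid X → FreeUnaryMonoid X → FreeUnaryMonoid X
  | empty, v => v
  | letter x w, v => letter x (append w v)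
  | bracket u w, v => bracket u (append w v)

theorem append_empty (u : FreeUnaryMonoid X) : append u empty = u := by
  induction u with
  | empty => rfl
  | letter x w ih => simp [append, ih]
  | bracket u w _ ih => simp [append, ih]

theorem append_assoc (u v w : FreeUnaryMonoid X) :
    append (append u v) w = append u (append v w) := by
  induction u with
  | empty => rfl
  | letter x w ih => simp [append, ih]
  | bracket u w _ ih => simp [append, ih]

instance : UnaryMonoid (FreeUnaryMonoid X) where
  mul := append
  one := empty
  mul_assoc := append_assoc
  one_mul _ := rfl
  mul_one := append_empty
  plus u := bracket u empty

/-- The generator of the free unary monoid corresponding to `x`. -/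
def of (x : X) : FreeUnaryMonoid X := letter x empty

/-- The length of a word: the number of appearances of letters of `X` in it, including those
inside brackets. -/
def length : FreeUnaryMonoid X → ℕ
  | empty => 0
  | letter _ w => 1 + length w
  | bracket u w => length u + length w

/-- Evaluation of a word in a unary monoid. -/
def eval {M : Type*} [UnaryMonoid M] (f : X → M) : FreeUnaryMonoid X → M
  | empty => 1
  | letter x w => f x * eval f w
  | bracket u w => plus (eval f u) * eval f w

theorem eval_append {M : Type*} [UnaryMonoid M] (f : X → M) (u v : FreeUnaryMonoid X) :
    eval f (append u v) = eval f u * eval f v := by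
  induction u with
  | empty => simp [append, eval]
  | letter x w ih => simp [append, eval, ih, mul_assoc]
  | bracket u w _ ih => simp [append, eval, ih, mul_assoc]

/-- Evaluation as a morphism of unary monoids. -/
def lift {M : Type*} [UnaryMonoid M] (f : X → M) : UnaryMonoidHom (FreeUnaryMonoid X) M where
  toFun := eval f
  map_one' := rfl
  map_mul' := eval_append f
  map_plus' _ := mul_one _

/-- Every morphism out of the free unary monoid is evaluation at the images of the letters. -/
theorem hom_eq_eval {M : Type*} [UnaryMonoid M] (g : UnaryMonoidHom (FreeUnaryMonoid X) M)
    (w : FreeUnaryMonoid X) : g w = eval (fun x => g (of x)) w := by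
  induction w with
  | empty => exact g.map_one'
  | letter x w ih => exact (g.map_mul' (of x) w).trans (congrArg _ ih)
  | bracket u w ihu ihw =>
    refine (g.map_mul' (plus u) w).trans ?_
    exact congrArg₂ _ ((g.map_plus' u).trans (congrArg plus ihu)) ihw

/-- The universal property of the free unary monoid. -/
theorem existsUnique_hom {M : Type*} [UnaryMonoid M] (f : X → M) :
    ∃! g : UnaryMonoidHom (FreeUnaryMonoid X) M, ∀ x, g (of x) = f x := by
  refine ⟨lift f, fun x => mul_one _, ?_⟩
  rintro ⟨⟨⟨g, h1⟩, h2⟩, h3⟩ hg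
  have key : g = eval f := by
    funext w
    refine (hom_eq_eval ⟨⟨⟨g, h1⟩, h2⟩, h3⟩ w).trans ?_
    exact congrArg (fun k => eval k w) (funext hg)
  subst key
  rfl

end FreeUnaryMonoid

/-- The congruence on the free unary monoid generated by the quasi-identities of left adequate
monoids: the least congruence whose quotient is left adequate. -/
inductive FLAdRel (X : Type*) : FreeUnaryMonoid X → FreeUnaryMonoid X → Prop
  | refl (x) : FLAdRel X x x
  | symm {x y} : FLAdRel X x y → FLAdRel X y x
  | trans {x y z} : FLAdRel X x y → FLAdRel X y z → FLAdRel X x z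
  | mul {x y z w} : FLAdRel X x y → FLAdRel X z w → FLAdRel X (x * z) (y * w)
  | plus {x y} : FLAdRel X x y → FLAdRel X (plus x) (plus y)
  | plus_mul_self (x) : FLAdRel X (plus x * x) x
  | plus_plus_mul_plus (x y) : FLAdRel X (plus (plus x * plus y)) (plus x * plus y)
  | plus_mul_comm (x y) : FLAdRel X (plus x * plus y) (plus y * plus x)
  | plus_mul (x y) : FLAdRel X (plus (x * y)) (plus (x * plus y))
  | eq_plus_of_idem (x) : FLAdRel X (x * x) x → FLAdRel X x (plus x)
  | mul_plus_cancel (x y z) : FLAdRel X (x * z) (y * z) → FLAdRel X (x * plus z) (y * plus z)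

/-- The congruence `FLAdRel` as a setoid. -/
def fladSetoid (X : Type*) : Setoid (FreeUnaryMonoid X) where
  r := FLAdRel X
  iseqv := ⟨.refl, .symm, .trans⟩

/-- The free left adequate monoid on `X`; that it is left adequate and has the universal property
is proved below. -/
def FLAd (X : Type*) : Type _ := Quotient (fladSetoid X)

namespace FLAd

variable {X : Type*}

instance : LeftAdequateMonoid (FLAd X) where
  mul := Quotient.map₂ (· * ·) fun _ _ h _ _ k => FLAdRel.mul h k
  one := Quotient.mk (fladSetoid X) 1
  plus := Quotient.map plus fun _ _ h => FLAdRel.plus h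
  mul_assoc := by
    rintro ⟨x⟩ ⟨y⟩ ⟨z⟩
    exact congrArg (Quotient.mk (fladSetoid X)) (mul_assoc x y z)
  one_mul := by
    rintro ⟨x⟩
    exact congrArg (Quotient.mk (fladSetoid X)) (one_mul x)
  mul_one := by
    rintro ⟨x⟩
    exact congrArg (Quotient.mk (fladSetoid X)) (mul_one x)
  plus_mul_self := by
    rintro ⟨x⟩
    exact Quotient.sound (s := fladSetoid X) (FLAdRel.plus_mul_self x)
  plus_plus_mul_plus := by
    rintro ⟨x⟩ ⟨y⟩
    exact Quotient.sound (s := fladSetoid X) (FLAdRel.plus_plus_mul_plus x y)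
  plus_mul_comm := by
    rintro ⟨x⟩ ⟨y⟩
    exact Quotient.sound (s := fladSetoid X) (FLAdRel.plus_mul_comm x y)
  plus_mul := by
    rintro ⟨x⟩ ⟨y⟩
    exact Quotient.sound (s := fladSetoid X) (FLAdRel.plus_mul x y)
  eq_plus_of_idem := by
    rintro ⟨x⟩ h
    exact Quotient.sound (s := fladSetoid X)
      (FLAdRel.eq_plus_of_idem x (Quotient.exact (s := fladSetoid X) h))
  mul_plus_cancel := by
    rintro ⟨x⟩ ⟨y⟩ ⟨z⟩ h
    exact Quotient.sound (s := fladSetoid X)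
      (FLAdRel.mul_plus_cancel x y z (Quotient.exact (s := fladSetoid X) h))

/-- The canonical surjective morphism from the free unary monoid. -/
def proj (X : Type*) : UnaryMonoidHom (FreeUnaryMonoid X) (FLAd X) where
  toFun := Quotient.mk (fladSetoid X)
  map_one' := rfl
  map_mul' _ _ := rfl
  map_plus' _ := rfl

theorem proj_surjective (X : Type*) : Function.Surjective (proj X) :=
  Quotient.mk_surjective

/-- The free generator corresponding to `x`. -/
def of (x : X) : FLAd X := proj X (FreeUnaryMonoid.of x)

theorem eval_eq_of_rel {M : Type*} [LeftAdequateMonoid M] (f : X → M) {u v : FreeUnaryMonoid X}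
    (h : FLAdRel X u v) : FreeUnaryMonoid.lift f u = FreeUnaryMonoid.lift f v := by
  have hm : ∀ x y, FreeUnaryMonoid.lift f (x * y) =
      FreeUnaryMonoid.lift f x * FreeUnaryMonoid.lift f y := (FreeUnaryMonoid.lift f).map_mul'
  have hp : ∀ x, FreeUnaryMonoid.lift f (plus x) = plus (FreeUnaryMonoid.lift f x) :=
    (FreeUnaryMonoid.lift f).map_plus'
  induction h with
  | refl => rfl
  | symm _ ih => exact ih.symm
  | trans _ _ ih ih' => exact ih.trans ih'
  | mul _ _ ih ih' => rw [hm, hm, ih, ih']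
  | plus _ ih => rw [hp, hp, ih]
  | plus_mul_self x => rw [hm, hp, LeftAdequateMonoid.plus_mul_self]
  | plus_plus_mul_plus x y => rw [hp, hm, hp, hp, LeftAdequateMonoid.plus_plus_mul_plus]
  | plus_mul_comm x y => rw [hm, hm, hp, hp, LeftAdequateMonoid.plus_mul_comm]
  | plus_mul x y => rw [hp, hp, hm, hm, hp, LeftAdequateMonoid.plus_mul]
  | eq_plus_of_idem x _ ih =>
    rw [hm] at ih
    rw [hp]
    exact LeftAdequateMonoid.eq_plus_of_idem _ ih
  | mul_plus_cancel x y z _ ih =>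
    rw [hm, hm] at ih
    rw [hm, hm, hp]
    exact LeftAdequateMonoid.mul_plus_cancel _ _ _ ih

/-- The morphism from the free left adequate monoid that extends `f`. -/
def lift {M : Type*} [LeftAdequateMonoid M] (f : X → M) : UnaryMonoidHom (FLAd X) M where
  toFun := Quotient.lift (FreeUnaryMonoid.lift f) fun _ _ h => eval_eq_of_rel f h
  map_one' := rfl
  map_mul' := by
    rintro ⟨x⟩ ⟨y⟩
    exact (FreeUnaryMonoid.lift f).map_mul' x y
  map_plus' := by
    rintro ⟨x⟩
    exact (FreeUnaryMonoid.lift f).map_plus' x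

/-- The universal property of the free left adequate monoid: every map from `X` to a left
adequate monoid extends uniquely to a morphism. -/
theorem existsUnique_hom {M : Type*} [LeftAdequateMonoid M] (f : X → M) :
    ∃! g : UnaryMonoidHom (FLAd X) M, ∀ x, g (of x) = f x := by
  refine ⟨lift f, fun x => mul_one _, ?_⟩
  rintro ⟨⟨⟨g, h1⟩, h2⟩, h3⟩ hg
  have key : g = lift f := by
    funext w
    obtain ⟨u, rfl⟩ := proj_surjective X w
    let g' : UnaryMonoidHom (FreeUnaryMonoid X) M :=
      ⟨⟨⟨fun v => g (proj X v), h1⟩, fun x y => h2 (proj X x) (proj X y)⟩,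
        fun x => h3 (proj X x)⟩
    refine (FreeUnaryMonoid.hom_eq_eval g' u).trans ?_
    exact congrArg (fun k => FreeUnaryMonoid.eval k u) (funext hg)
  subst key
  rfl

/-- The ball of size `n`: the elements represented by some word of length at most `n`. -/
def ball (X : Type*) (n : ℕ) : Set (FLAd X) :=
  {T | ∃ w : FreeUnaryMonoid X, w.length ≤ n ∧ T = proj X w}

/-- The sphere of size `n`: the ball of size `n` without the ball of size `n - 1`, where the ball
of size `-1` is empty. -/
def sphere (X : Type*) : ℕ → Set (FLAd X)
  | 0 => ball X 0
  | n + 1 => ball X (n + 1) \ ball X n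

end FLAd

/-- A function `f : ℕ → ℕ` has intermediate growth if it grows faster than every polynomial and
slower than every exponential `c ^ n` with `c > 1`. -/
def HasIntermediateGrowth (f : ℕ → ℕ) : Prop :=
  (∀ d : ℕ, (fun n : ℕ => (n : ℝ) ^ d) =o[atTop] (fun n : ℕ => (f n : ℝ))) ∧
  (∀ c : ℝ, 1 < c → (fun n : ℕ => (f n : ℝ)) =o[atTop] (fun n : ℕ => c ^ n))

/-!
Elements of the free left adequate monoid on one generator `a` are trees with a distinguished
trunk, in which branches that fold into the rest of the tree are discarded. With one generator the
edges carry no labels, so the branches at a trunk vertex fold into the longest path among them, an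
element `(a ^ b)^+`. Every element is therefore a comb `(a ^ b₀)^+ a (a ^ b₁)^+ ⋯ a (a ^ bₖ)^+`,
and the comb is reduced if each `bᵢ` is zero or larger than the height of what lies beyond the
`i`-th trunk vertex. The quasi-identities reduce every word to a reduced comb that is not longer
(`FreeUnaryMonoid.exists_reduced_eval_eq`).

Reduced combs are distinct elements (`FLAd.comb_of_injective`): they are separated by the left
adequate monoid `Profile`, which records the length of the trunk and, for each trunk vertex, how
far from the root the tree extends at or beyond that vertex. Hence the sphere of size `n` is in
bijection with the reduced lists `[b₀, …, bₖ]` with `k + ∑ bᵢ = n` (`FLAd.sphere_eq_image`).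

These lists correspond to the partitions of `n + 1` into `k + 1` parts
(`reducedEquivPartition`). Recursively, a leading `0` contributes a part `1`, and a leading `b ≠ 0`
increases every other part by one and contributes a new largest part; that the list is reduced is
exactly what makes the new part the largest. The recursion is inverted by looking whether `1` is a
part.

For the growth of the partition numbers, the product of the geometric series `∑ x ^ (j c)`, which is
bounded for each fixed `0 < x < 1`, gives the upper bound (`exists_card_partition_le`), and free
choice of the multiplicities of the parts `2, …, r + 1` gives at least a constant times `n ^ r`
partitions (`exists_pow_le_card_partition`). Summing over spheres transfers the bounds to balls.
-/

/-! ### Identities in left adequate monoids -/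

namespace LeftAdequateMonoid

variable {M : Type*} [LeftAdequateMonoid M]

theorem plus_one : plus (1 : M) = 1 :=
  (eq_plus_of_idem 1 (mul_one 1)).symm

theorem plus_plus_mul (x y : M) : plus (plus x * y) = plus x * plus y := by
  rw [plus_mul, plus_plus_mul_plus]

theorem plus_mul_plus_mul (x y : M) : plus x * plus (x * y) = plus (x * y) := by
  rw [← plus_plus_mul, ← mul_assoc, plus_mul_self]

end LeftAdequateMonoid

/-! ### Products of trunks and branches -/

section Branches

open LeftAdequateMonoid

variable {M : Type*} [LeftAdequateMonoid M]

/-- The element `(a ^ n)^+`: a path of length `n` that hangs off the current vertex. -/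
def branch (a : M) (n : ℕ) : M := plus (a ^ n)

theorem branch_zero (a : M) : branch a 0 = 1 := by
  rw [branch, pow_zero, plus_one]

theorem branch_mul_branch_of_le (a : M) {m n : ℕ} (h : m ≤ n) :
    branch a m * branch a n = branch a n := by
  obtain ⟨k, rfl⟩ := Nat.exists_eq_add_of_le h
  rw [branch, branch, pow_add, plus_mul_plus_mul]

theorem branch_mul_branch (a : M) (m n : ℕ) :
    branch a m * branch a n = branch a (max m n) := by
  rcases le_total m n with h | h
  · rw [branch_mul_branch_of_le a h, max_eq_right h]
  · rw [max_eq_left h]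
    exact (plus_mul_comm _ _).trans (branch_mul_branch_of_le a h)

theorem plus_mul_branch (a : M) (n : ℕ) : plus (a * branch a n) = branch a (n + 1) := by
  rw [branch, branch, ← plus_mul, pow_succ']

/-- The element `a (a ^ b₁)^+ a (a ^ b₂)^+ ⋯ a (a ^ bₖ)^+` for the list `[b₁, …, bₖ]`: a trunk
of length `k` with a branch of length `bᵢ` at its `i`-th vertex and none at its root. -/
def trunk (a : M) : List ℕ → M
  | [] => 1
  | b :: l => a * (branch a b * trunk a l)

/-- The element `(a ^ b₀)^+ a (a ^ b₁)^+ ⋯ a (a ^ bₖ)^+` for the nonempty list `[b₀, …, bₖ]`,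
with the value `1` at the empty list. -/
def comb (a : M) : List ℕ → M
  | [] => 1
  | b :: l => branch a b * trunk a l

/-- The height of the tree of `trunk a l`, that is, its longest distance from the root. -/
def depth : List ℕ → ℕ
  | [] => 0
  | b :: l => 1 + max b (depth l)

/-- A list is reduced if no nontrivial branch can be folded into the part of the tree that lies
beyond its starting vertex. -/
def Reduced : List ℕ → Prop
  | [] => True
  | b :: l => (b = 0 ∨ depth l < b) ∧ Reduced l

/-- The total number of edges, with one edge added that leads to the root of `comb a l`. -/
def size (l : List ℕ) : ℕ := l.sum + l.length

theorem size_cons (b : ℕ) (l : List ℕ) : size (b :: l) = b + 1 + size l := by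
  simp only [size, List.sum_cons, List.length_cons]; omega

theorem length_le_depth (l : List ℕ) : l.length ≤ depth l := by
  induction l with
  | nil => simp [depth]
  | cons b l ih => simp only [depth, List.length_cons]; omega

theorem depth_le_size (l : List ℕ) : depth l ≤ size l := by
  induction l with
  | nil => simp [depth]
  | cons b l ih => simp only [depth, size_cons]; omega

theorem plus_branch_mul (a x : M) (b : ℕ) : plus (branch a b * x) = branch a b * plus x :=
  plus_plus_mul _ _

theorem plus_trunk (a : M) (l : List ℕ) : plus (trunk a l) = branch a (depth l) := by
  induction l with
  | nil => rw [trunk, depth, branch_zero, plus_one]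
  | cons b l ih =>
    rw [trunk, LeftAdequateMonoid.plus_mul, plus_branch_mul, ih, branch_mul_branch,
      plus_mul_branch, depth, add_comm]

theorem branch_mul_trunk_of_le (a : M) {b : ℕ} {l : List ℕ} (h : b ≤ depth l) :
    branch a b * trunk a l = trunk a l := by
  rw [← plus_mul_self (trunk a l), ← mul_assoc, plus_trunk, branch_mul_branch_of_le a h]

/-- A branch at the root either folds into the trunk and its branches or is kept. -/
theorem exists_reduced_branch_mul_trunk (a : M) (b : ℕ) {l : List ℕ} (hl : Reduced l) :
    ∃ c ≤ b, Reduced (c :: l) ∧ branch a b * trunk a l = comb a (c :: l) := by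
  rcases le_or_gt b (depth l) with h | h
  · exact ⟨0, b.zero_le, ⟨Or.inl rfl, hl⟩, by
      rw [comb, branch_zero, one_mul, branch_mul_trunk_of_le a h]⟩
  · exact ⟨b, le_rfl, ⟨Or.inr h, hl⟩, rfl⟩

/-- Over one generator, every word has the same value as some reduced comb that is not longer. -/
theorem FreeUnaryMonoid.exists_reduced_eval_eq {X : Type*} [Unique X] (f : X → M)
    (w : FreeUnaryMonoid X) :
    ∃ b l, Reduced (b :: l) ∧ size (b :: l) ≤ w.length + 1 ∧
      w.eval f = comb (f default) (b :: l) := by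
  induction w with
  | empty =>
    exact ⟨0, [], ⟨Or.inl rfl, trivial⟩, by simp [size], by
      rw [eval, comb, branch_zero, trunk, one_mul]⟩
  | letter x w ih =>
    obtain ⟨b, l, hl, hs, he⟩ := ih
    refine ⟨0, b :: l, ⟨Or.inl rfl, hl⟩, ?_, ?_⟩
    · rw [size_cons, length]; omega
    · rw [eval, he, comb, comb, branch_zero, one_mul, trunk, Unique.eq_default x]
  | bracket u w ihu ihw =>
    obtain ⟨b, l, hl, hs, he⟩ := ihu
    obtain ⟨c, k, hk, ht, hf⟩ := ihw
    obtain ⟨d, hd, hr, hv⟩ := exists_reduced_branch_mul_trunk (f default)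
      (max (max b (depth l)) c) hk.2
    refine ⟨d, k, hr, ?_, ?_⟩
    · have := depth_le_size l
      rw [size_cons] at hs ht ⊢
      rw [length]
      omega
    · rw [eval, he, hf, ← hv, comb, comb, plus_branch_mul, plus_trunk, branch_mul_branch,
        ← mul_assoc, branch_mul_branch]

namespace FreeUnaryMonoid

variable {X : Type*}

theorem length_mul (u v : FreeUnaryMonoid X) : (u * v).length = u.length + v.length := by
  change (append u v).length = _
  induction u with
  | empty => simp [append, length]
  | letter x w ih => simp [append, length, ih, add_assoc]
  | bracket u w _ ih => simp [append, length, ih, add_assoc]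

theorem length_plus (u : FreeUnaryMonoid X) : (plus u).length = u.length := by
  change u.length + 0 = u.length
  rw [add_zero]

theorem length_of_pow (x : X) (n : ℕ) : (of x ^ n).length = n := by
  induction n with
  | zero => rfl
  | succ n ih => rw [pow_succ, length_mul, ih]; rfl

end FreeUnaryMonoid

theorem UnaryMonoidHom.map_mul {M N : Type*} [UnaryMonoid M] [UnaryMonoid N]
    (f : UnaryMonoidHom M N) (x y : M) : f (x * y) = f x * f y := f.map_mul' x y

theorem UnaryMonoidHom.map_plus {M N : Type*} [UnaryMonoid M] [UnaryMonoid N]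
    (f : UnaryMonoidHom M N) (x : M) : f (plus x) = plus (f x) := f.map_plus' x

theorem UnaryMonoidHom.map_pow {M N : Type*} [UnaryMonoid M] [UnaryMonoid N]
    (f : UnaryMonoidHom M N) (x : M) (n : ℕ) : f (x ^ n) = f x ^ n :=
  _root_.map_pow f.toMonoidHom x n

theorem UnaryMonoidHom.map_branch {N : Type*} [LeftAdequateMonoid N]
    (f : UnaryMonoidHom M N) (a : M) (n : ℕ) : f (branch a n) = branch (f a) n := by
  rw [branch, branch, f.map_plus, f.map_pow]

theorem UnaryMonoidHom.map_trunk {N : Type*} [LeftAdequateMonoid N]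
    (f : UnaryMonoidHom M N) (a : M) (l : List ℕ) : f (trunk a l) = trunk (f a) l := by
  induction l with
  | nil => exact f.map_one'
  | cons b l ih => rw [trunk, trunk, f.map_mul, f.map_mul, f.map_branch, ih]

theorem UnaryMonoidHom.map_comb {N : Type*} [LeftAdequateMonoid N]
    (f : UnaryMonoidHom M N) (a : M) (l : List ℕ) : f (comb a l) = comb (f a) l := by
  cases l with
  | nil => exact f.map_one'
  | cons b l => rw [comb, comb, f.map_mul, f.map_branch, f.map_trunk]

namespace FLAd

variable {X : Type*}

theorem exists_length_eq_branch (x : X) (n : ℕ) :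
    ∃ w : FreeUnaryMonoid X, w.length = n ∧ proj X w = branch (of x) n :=
  ⟨plus (FreeUnaryMonoid.of x ^ n), by
    rw [FreeUnaryMonoid.length_plus, FreeUnaryMonoid.length_of_pow], by
    rw [UnaryMonoidHom.map_plus, UnaryMonoidHom.map_pow]; rfl⟩

theorem exists_length_eq_trunk (x : X) (l : List ℕ) :
    ∃ w : FreeUnaryMonoid X, w.length = size l ∧ proj X w = trunk (of x) l := by
  induction l with
  | nil => exact ⟨1, rfl, rfl⟩
  | cons b l ih =>
    obtain ⟨w, hw, h⟩ := ih
    obtain ⟨v, hv, h'⟩ := exists_length_eq_branch x b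
    refine ⟨FreeUnaryMonoid.of x * (v * w), ?_, ?_⟩
    · rw [FreeUnaryMonoid.length_mul, FreeUnaryMonoid.length_mul, hv, hw, size_cons,
        FreeUnaryMonoid.of, FreeUnaryMonoid.length, FreeUnaryMonoid.length]
      omega
    · rw [UnaryMonoidHom.map_mul, UnaryMonoidHom.map_mul, h, h', trunk]; rfl

theorem exists_length_eq_comb (x : X) (b : ℕ) (l : List ℕ) :
    ∃ w : FreeUnaryMonoid X, w.length + 1 = size (b :: l) ∧
      proj X w = comb (of x) (b :: l) := by
  obtain ⟨w, hw, h⟩ := exists_length_eq_trunk x l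
  obtain ⟨v, hv, h'⟩ := exists_length_eq_branch x b
  refine ⟨v * w, ?_, ?_⟩
  · rw [FreeUnaryMonoid.length_mul, hv, hw, size_cons]; omega
  · rw [UnaryMonoidHom.map_mul, h, h', comb]

theorem exists_reduced_proj_eq [Unique X] (w : FreeUnaryMonoid X) :
    ∃ b l, Reduced (b :: l) ∧ size (b :: l) ≤ w.length + 1 ∧
      proj X w = comb (of default) (b :: l) := by
  rw [FreeUnaryMonoid.hom_eq_eval]
  exact FreeUnaryMonoid.exists_reduced_eval_eq (fun x => proj X (FreeUnaryMonoid.of x)) w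

end FLAd

end Branches

/-! ### A monoid that separates reduced combs -/

/-- The profile of a tree with all edges unlabelled and directed away from the root: the length of
its trunk and, for each trunk vertex `i`, the largest distance `reach i` from the root of a vertex
at or beyond `i`. Beyond the trunk, `reach` is the identity, which makes the product formula
uniform. -/
@[ext]
structure Profile where
  trunk : ℕ
  reach : ℕ → ℕ
  trunk_le_reach : ∀ i ≤ trunk, trunk ≤ reach i
  reach_of_trunk_lt : ∀ i, trunk < i → reach i = i

namespace Profile

theorem le_reach (p : Profile) (i : ℕ) : i ≤ p.reach i ∧ p.trunk ≤ p.reach i := by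
  rcases le_or_gt i p.trunk with h | h
  · have := p.trunk_le_reach i h
    omega
  · have := p.reach_of_trunk_lt i h
    omega

/-- The profile of a branch of length `n` at the root. -/
def stem (n : ℕ) : Profile where
  trunk := 0
  reach i := if i = 0 then n else i
  trunk_le_reach _ _ := Nat.zero_le _
  reach_of_trunk_lt _ hi := if_neg hi.ne'

/-- The second tree is attached to the end of the trunk of the first. -/
instance : Mul Profile where
  mul p q :=
    { trunk := p.trunk + q.trunk
      reach := fun i => max (p.reach i) (p.trunk + q.reach (i - p.trunk))
      trunk_le_reach := fun i _ => by
        have := (q.le_reach (i - p.trunk)).2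
        omega
      reach_of_trunk_lt := fun i hi => by
        rw [p.reach_of_trunk_lt i (by omega), q.reach_of_trunk_lt _ (by omega)]
        omega }

@[simp] theorem mul_trunk (p q : Profile) : (p * q).trunk = p.trunk + q.trunk := rfl

@[simp] theorem mul_reach (p q : Profile) (i : ℕ) :
    (p * q).reach i = max (p.reach i) (p.trunk + q.reach (i - p.trunk)) := rfl

@[simp] theorem stem_trunk (n : ℕ) : (stem n).trunk = 0 := rfl

theorem stem_reach (n i : ℕ) : (stem n).reach i = if i = 0 then n else i := rfl

@[simp] theorem stem_reach_zero (n : ℕ) : (stem n).reach 0 = n := rfl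

@[simp] theorem stem_reach_succ (n i : ℕ) : (stem n).reach (i + 1) = i + 1 := rfl

theorem ext' {p q : Profile} (h : p.trunk = q.trunk) (h' : ∀ i, p.reach i = q.reach i) :
    p = q := Profile.ext h (funext h')

theorem stem_mul_stem (m n : ℕ) : stem m * stem n = stem (max m n) := by
  refine ext' rfl fun i => ?_
  cases i <;> simp

theorem stem_mul_reach_zero (n : ℕ) (p : Profile) :
    (stem n * p).reach 0 = max n (p.reach 0) := by simp

theorem stem_mul_reach_succ (n : ℕ) (p : Profile) (i : ℕ) :
    (stem n * p).reach (i + 1) = p.reach (i + 1) := by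
  have := (p.le_reach (i + 1)).1
  simpa using this

theorem stem_mul_of_le {n : ℕ} {p : Profile} (h : n ≤ p.reach 0) : stem n * p = p := by
  refine ext' (by simp) fun i => ?_
  cases i with
  | zero => rw [stem_mul_reach_zero, max_eq_right h]
  | succ i => rw [stem_mul_reach_succ]

/-- The identity is the tree with one vertex. -/
instance : Monoid Profile where
  one := stem 0
  mul_assoc p q r := by
    refine ext' (Nat.add_assoc ..) fun i => ?_
    simp only [mul_reach, mul_trunk, Nat.sub_add_eq]
    omega
  one_mul p := stem_mul_of_le (Nat.zero_le _)
  mul_one p := by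
    refine ext' rfl fun i => ?_
    change max (p.reach i) (p.trunk + (stem 0).reach (i - p.trunk)) = p.reach i
    have := p.le_reach i
    rw [stem_reach]
    split_ifs <;> omega

theorem eq_stem_of_trunk_eq_zero {p : Profile} (h : p.trunk = 0) : p = stem (p.reach 0) := by
  refine ext' h fun i => ?_
  cases i with
  | zero => rfl
  | succ i => exact p.reach_of_trunk_lt _ (by omega)

/-- The unary operation moves the end vertex to the root, so that only the height is left. -/
instance : LeftAdequateMonoid Profile where
  plus p := stem (p.reach 0)
  plus_mul_self p := stem_mul_of_le le_rfl
  plus_plus_mul_plus p q := by simp [stem_mul_stem]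
  plus_mul_comm p q := by rw [stem_mul_stem, stem_mul_stem, max_comm]
  plus_mul p q := by simp
  eq_plus_of_idem p h := by
    have := congrArg trunk h
    rw [mul_trunk] at this
    exact eq_stem_of_trunk_eq_zero (by omega)
  mul_plus_cancel p q r h := by
    have ht : p.trunk = q.trunk := by simpa using congrArg trunk h
    refine ext' (by simpa using ht) fun i => ?_
    have hi := congrArg (fun s => reach s i) h
    simp only [mul_reach, ht] at hi ⊢
    rcases le_or_gt i q.trunk with h' | h'
    · rw [Nat.sub_eq_zero_of_le h'] at hi ⊢
      exact hi
    · rw [p.reach_of_trunk_lt i (by omega), q.reach_of_trunk_lt i h']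

theorem plus_eq (p : Profile) : plus p = stem (p.reach 0) := rfl

/-- The profile of a single edge. -/
def edge : Profile where
  trunk := 1
  reach i := max i 1
  trunk_le_reach _ _ := by omega
  reach_of_trunk_lt _ _ := by omega

theorem edge_mul_reach_zero (p : Profile) : (edge * p).reach 0 = p.reach 0 + 1 := by
  simp [edge, add_comm]

theorem edge_mul_reach_succ (p : Profile) (i : ℕ) :
    (edge * p).reach (i + 1) = p.reach i + 1 := by
  have := (p.le_reach i).1
  simp only [mul_reach, edge, Nat.add_sub_cancel]
  omega

theorem edge_pow_reach_zero (n : ℕ) : (edge ^ n).reach 0 = n := by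
  induction n with
  | zero => rfl
  | succ n ih => rw [pow_succ', edge_mul_reach_zero, ih]

theorem branch_edge (n : ℕ) : branch edge n = stem n := by
  rw [branch, plus_eq, edge_pow_reach_zero]

/-- Seen in the model, `plus_trunk` says that `depth` is the height of the tree. -/
theorem trunk_edge_reach_zero (l : List ℕ) : (_root_.trunk edge l).reach 0 = depth l := by
  have h := congrArg (fun p => reach p 0) (plus_trunk edge l)
  simpa [plus_eq, branch_edge] using h

theorem comb_edge_trunk (b : ℕ) (l : List ℕ) : (comb edge (b :: l)).trunk = l.length := by
  rw [comb, branch_edge, mul_trunk, stem_trunk, zero_add]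
  induction l with
  | nil => rfl
  | cons c l ih =>
    rw [_root_.trunk, branch_edge, mul_trunk, mul_trunk, ih, List.length_cons, add_comm,
      stem_trunk, zero_add]
    rfl

theorem comb_edge_reach_zero (b : ℕ) (l : List ℕ) :
    (comb edge (b :: l)).reach 0 = max b (depth l) := by
  rw [comb, branch_edge, stem_mul_reach_zero, trunk_edge_reach_zero]

/-- Removing the first branch and the first edge of a trunk is visible in the profile. -/
theorem comb_edge_reach_succ (b c : ℕ) (l : List ℕ) (i : ℕ) :
    (comb edge (b :: c :: l)).reach (i + 1) = (comb edge (c :: l)).reach i + 1 := by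
  rw [comb, branch_edge, stem_mul_reach_succ, _root_.trunk, edge_mul_reach_succ, comb]

/-- The length of the trunk and the values of `reach` at positive arguments determine the tail of
the list; the value at `0` then determines the first branch, since a nonzero branch of a reduced list exceeds the height of
the rest. -/
theorem comb_edge_injective {b c : ℕ} {l k : List ℕ} (hl : Reduced (b :: l))
    (hk : Reduced (c :: k)) (h : comb edge (b :: l) = comb edge (c :: k)) :
    b :: l = c :: k := by
  induction l generalizing b c k with
  | nil =>
    have ht := congrArg trunk h
    rw [comb_edge_trunk, comb_edge_trunk] at ht
    obtain rfl := List.length_eq_zero_iff.1 ht.symm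
    have h0 := congrArg (fun p => reach p 0) h
    simp only [comb_edge_reach_zero, depth] at h0
    rw [show b = c by omega]
  | cons d l ih =>
    have ht := congrArg trunk h
    rw [comb_edge_trunk, comb_edge_trunk] at ht
    obtain ⟨e, k, rfl⟩ := List.exists_cons_of_length_eq_add_one ht.symm
    have hs : comb edge (d :: l) = comb edge (e :: k) := by
      refine ext' ?_ fun i => ?_
      · rw [comb_edge_trunk, comb_edge_trunk]
        simpa using ht
      · have hi := congrArg (fun p => reach p (i + 1)) h
        simpa only [comb_edge_reach_succ, add_left_inj] using hi
    have hlk := ih hl.2 hk.2 hs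
    rw [← hlk] at h hk ⊢
    have h0 := congrArg (fun p => reach p 0) h
    simp only [comb_edge_reach_zero] at h0
    have h1 := hl.1
    have h2 := hk.1
    rw [show b = c by omega]

end Profile

namespace FLAd

/-- Distinct reduced combs in a free generator are distinct elements. -/
theorem comb_of_injective {X : Type*} (x : X) {b c : ℕ} {l k : List ℕ} (hl : Reduced (b :: l))
    (hk : Reduced (c :: k)) (h : comb (of x) (b :: l) = comb (of x) (c :: k)) :
    b :: l = c :: k := by
  have h' := congrArg (lift fun _ : X => Profile.edge) h
  have hx : lift (fun _ : X => Profile.edge) (of x) = Profile.edge := mul_one _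
  rw [UnaryMonoidHom.map_comb, UnaryMonoidHom.map_comb, hx] at h'
  exact Profile.comb_edge_injective hl hk h'

end FLAd

/-! ### Reduced lists and partitions -/

/-- The multiset of parts attached to a list. A leading entry `0` contributes a part `1`; a leading
entry `b ≠ 0` of a reduced list `b :: l` contributes a hook, that is, every earlier part grows
by one and a new largest part is added. -/
def parts : List ℕ → Multiset ℕ
  | [] => 0
  | b :: l => if b = 0 then 1 ::ₘ parts l
      else (b - l.length + 1) ::ₘ (parts l).map (· + 1)

theorem parts_zero_cons (l : List ℕ) : parts (0 :: l) = 1 ::ₘ parts l := if_pos rfl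

theorem parts_cons {b : ℕ} (hb : b ≠ 0) (l : List ℕ) :
    parts (b :: l) = (b - l.length + 1) ::ₘ (parts l).map (· + 1) := if_neg hb

theorem card_parts (l : List ℕ) : (parts l).card = l.length := by
  induction l with
  | nil => rfl
  | cons b l ih =>
    rcases eq_or_ne b 0 with rfl | hb
    · simp [parts_zero_cons, ih]
    · simp [parts_cons hb, ih]

theorem pos_of_mem_parts {l : List ℕ} {x : ℕ} (hx : x ∈ parts l) : 0 < x := by
  induction l generalizing x with
  | nil => simp [parts] at hx
  | cons b l ih =>
    rcases eq_or_ne b 0 with rfl | hb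
    · rw [parts_zero_cons, Multiset.mem_cons] at hx
      rcases hx with rfl | hx
      exacts [one_pos, ih hx]
    · rw [parts_cons hb, Multiset.mem_cons, Multiset.mem_map] at hx
      rcases hx with rfl | ⟨y, -, rfl⟩ <;> omega

theorem sum_map_add_one (s : Multiset ℕ) : (s.map (· + 1)).sum = s.sum + s.card := by
  simp [Multiset.sum_map_add]

theorem sum_parts {l : List ℕ} (hl : Reduced l) : (parts l).sum = size l := by
  induction l with
  | nil => rfl
  | cons b l ih =>
    rcases eq_or_ne b 0 with rfl | hb
    · rw [parts_zero_cons, Multiset.sum_cons, ih hl.2, size_cons]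
    · have h1 := hl.1.resolve_left hb
      have h2 := length_le_depth l
      rw [parts_cons hb, Multiset.sum_cons, sum_map_add_one, ih hl.2, size_cons, card_parts]
      omega

/-- Together with `exists_mem_parts_add_length`, this says that the largest part determines the
depth. -/
theorem add_length_le_of_mem_parts {l : List ℕ} (hl : Reduced l) {x : ℕ} (hx : x ∈ parts l) :
    x + l.length ≤ depth l + 1 := by
  induction l generalizing x with
  | nil => simp [parts] at hx
  | cons b l ih =>
    have h2 := length_le_depth l
    rw [List.length_cons, depth]
    rcases eq_or_ne b 0 with rfl | hb
    · rw [parts_zero_cons, Multiset.mem_cons] at hx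
      rcases hx with rfl | hx
      · omega
      · have := ih hl.2 hx
        omega
    · have h1 := hl.1.resolve_left hb
      rw [parts_cons hb, Multiset.mem_cons, Multiset.mem_map] at hx
      rcases hx with rfl | ⟨y, hy, rfl⟩
      · omega
      · have := ih hl.2 hy
        omega

theorem exists_mem_parts_add_length {l : List ℕ} (hl : Reduced l) (h : l ≠ []) :
    ∃ x ∈ parts l, x + l.length = depth l + 1 := by
  induction l with
  | nil => exact absurd rfl h
  | cons b l ih =>
    have h2 := length_le_depth l
    rw [List.length_cons, depth]
    rcases eq_or_ne b 0 with rfl | hb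
    · rw [parts_zero_cons]
      rcases eq_or_ne l [] with rfl | hn
      · exact ⟨1, by simp, by simp [depth]⟩
      · obtain ⟨x, hx, he⟩ := ih hl.2 hn
        exact ⟨x, Multiset.mem_cons_of_mem hx, by omega⟩
    · have h1 := hl.1.resolve_left hb
      rw [parts_cons hb]
      exact ⟨_, Multiset.mem_cons_self _ _, by omega⟩

theorem one_mem_parts_cons {b : ℕ} {l : List ℕ} (hl : Reduced (b :: l)) :
    1 ∈ parts (b :: l) ↔ b = 0 := by
  rcases eq_or_ne b 0 with rfl | hb
  · simp [parts_zero_cons]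
  · have h1 := hl.1.resolve_left hb
    have h2 := length_le_depth l
    refine ⟨fun h => ?_, fun h => absurd h hb⟩
    rw [parts_cons hb, Multiset.mem_cons, Multiset.mem_map] at h
    rcases h with h | ⟨y, hy, h⟩
    · omega
    · have := pos_of_mem_parts hy
      omega

theorem parts_injective {l k : List ℕ} (hl : Reduced l) (hk : Reduced k)
    (h : parts l = parts k) : l = k := by
  induction l generalizing k with
  | nil =>
    have hc := congrArg Multiset.card h
    rw [card_parts, card_parts] at hc
    exact (List.length_eq_zero_iff.1 hc.symm).symm
  | cons b l ih =>
    have hc := congrArg Multiset.card h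
    rw [card_parts, card_parts] at hc
    obtain ⟨c, k, rfl⟩ := List.exists_cons_of_length_eq_add_one hc.symm
    have hlen : l.length = k.length := by simpa using hc
    have h1 : b = 0 ↔ c = 0 := by rw [← one_mem_parts_cons hl, ← one_mem_parts_cons hk, h]
    rcases eq_or_ne b 0 with rfl | hb
    · obtain rfl := h1.1 rfl
      rw [parts_zero_cons, parts_zero_cons, Multiset.cons_inj_right] at h
      rw [ih hl.2 hk.2 h]
    · have hc0 : c ≠ 0 := fun h' => hb (h1.2 h')
      -- The new part is the largest one, so it is the same on both sides.
      have hb' : b - l.length + 1 + (c :: k).length ≤ depth (c :: k) + 1 :=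
        add_length_le_of_mem_parts hk (h ▸ by rw [parts_cons hb]; exact Multiset.mem_cons_self _ _)
      have hc' : c - k.length + 1 + (b :: l).length ≤ depth (b :: l) + 1 :=
        add_length_le_of_mem_parts hl (h ▸ by rw [parts_cons hc0]; exact Multiset.mem_cons_self _ _)
      have h2 := hl.1.resolve_left hb
      have h3 := hk.1.resolve_left hc0
      have h4 := length_le_depth l
      have h5 := length_le_depth k
      rw [List.length_cons, depth] at hb' hc'
      obtain rfl : b = c := by omega
      rw [parts_cons hb, parts_cons hb, hlen, Multiset.cons_inj_right] at h
      rw [ih hl.2 hk.2 (Multiset.map_injective (add_left_injective 1) h)]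

/-- If `1` is a part, it comes from a leading `0`. Otherwise the largest part comes from a leading
nonzero entry, and the other parts have been increased by one. -/
theorem exists_reduced_parts_eq (s : Multiset ℕ) (hs : ∀ x ∈ s, 0 < x) :
    ∃ l, Reduced l ∧ parts l = s := by
  induction hn : s.card generalizing s with
  | zero => exact ⟨[], trivial, (Multiset.card_eq_zero.1 hn).symm⟩
  | succ n ih =>
    by_cases h1 : 1 ∈ s
    · obtain ⟨l, hl, he⟩ := ih (s.erase 1) (fun x hx => hs x (Multiset.mem_of_mem_erase hx))
        (by rw [Multiset.card_erase_of_mem h1, hn]; rfl)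
      exact ⟨0 :: l, ⟨Or.inl rfl, hl⟩, by rw [parts_zero_cons, he, Multiset.cons_erase h1]⟩
    · have h2 : ∀ x ∈ s, 2 ≤ x := fun x hx => by
        have := hs x hx
        have : x ≠ 1 := fun h => h1 (h ▸ hx)
        omega
      have hne : s.toFinset.Nonempty := by
        rw [Multiset.toFinset_nonempty]
        rintro rfl
        simp at hn
      obtain ⟨m, hm, hmax⟩ := s.toFinset.exists_max_image id hne
      simp only [Multiset.mem_toFinset, id] at hm hmax
      obtain ⟨l, hl, he⟩ := ih ((s.erase m).map (· - 1))
        (fun x hx => by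
          obtain ⟨y, hy, rfl⟩ := Multiset.mem_map.1 hx
          have := h2 y (Multiset.mem_of_mem_erase hy)
          omega)
        (by rw [Multiset.card_map, Multiset.card_erase_of_mem hm, hn]; rfl)
      have hm2 := h2 m hm
      have hd : depth l < m - 1 + l.length := by
        rcases eq_or_ne l [] with rfl | hn
        · simp only [depth, List.length_nil]; omega
        · obtain ⟨x, hx, hxl⟩ := exists_mem_parts_add_length hl hn
          rw [he] at hx
          obtain ⟨y, hy, rfl⟩ := Multiset.mem_map.1 hx
          have := hmax y (Multiset.mem_of_mem_erase hy)
          have := h2 y (Multiset.mem_of_mem_erase hy)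
          omega
      refine ⟨(m - 1 + l.length) :: l, ⟨Or.inr hd, hl⟩, ?_⟩
      rw [parts_cons (by omega), he, Multiset.map_map, Nat.add_sub_cancel,
        Nat.sub_add_cancel (by omega)]
      conv_rhs => rw [← Multiset.cons_erase hm]
      congr 1
      conv_rhs => rw [← Multiset.map_id (s.erase m)]
      refine Multiset.map_congr rfl fun x hx => ?_
      have := h2 x (Multiset.mem_of_mem_erase hx)
      simp only [Function.comp, id]
      omega

/-- Reduced lists of size `n` correspond to the partitions of `n`. -/
noncomputable def reducedEquivPartition (n : ℕ) :
    {l : List ℕ // Reduced l ∧ size l = n} ≃ Nat.Partition n :=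
  Equiv.ofBijective
    (fun l => ⟨parts l.1, pos_of_mem_parts, (sum_parts l.2.1).trans l.2.2⟩)
    ⟨fun l k h => Subtype.ext
      (parts_injective l.2.1 k.2.1 (congrArg Nat.Partition.parts h)), fun p => by
      obtain ⟨l, hl, he⟩ := exists_reduced_parts_eq p.parts fun x hx => p.parts_pos hx
      exact ⟨⟨l, hl, by rw [← sum_parts hl, he, p.parts_sum]⟩, Nat.Partition.ext he⟩⟩

/-! ### Spheres and balls -/

namespace FLAd

variable (X : Type*)

theorem ball_succ (n : ℕ) : ball X (n + 1) = ball X n ∪ sphere X (n + 1) := by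
  have h : ball X n ⊆ ball X (n + 1) := fun _ ⟨w, hw, he⟩ => ⟨w, hw.trans n.le_succ, he⟩
  rw [sphere, Set.union_sdiff_cancel h]

theorem ncard_ball_le (n : ℕ) :
    (ball X n).ncard ≤ ∑ i ∈ Finset.range (n + 1), (sphere X i).ncard := by
  induction n with
  | zero => simp [sphere]
  | succ n ih =>
    rw [ball_succ, Finset.sum_range_succ]
    exact (Set.ncard_union_le _ _).trans (by gcongr)

variable [Unique X]

theorem mem_ball_iff (n : ℕ) (T : FLAd X) :
    T ∈ ball X n ↔ ∃ b l, Reduced (b :: l) ∧ size (b :: l) ≤ n + 1 ∧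
      comb (of default) (b :: l) = T := by
  constructor
  · rintro ⟨w, hw, rfl⟩
    obtain ⟨b, l, hl, hs, he⟩ := exists_reduced_proj_eq w
    exact ⟨b, l, hl, by omega, he.symm⟩
  · rintro ⟨b, l, -, hs, rfl⟩
    obtain ⟨w, hw, he⟩ := exists_length_eq_comb (default : X) b l
    exact ⟨w, by omega, he.symm⟩

/-- A reduced comb is a shortest representative of its element, so its size decides the sphere
it lies in. -/
theorem sphere_eq_image (n : ℕ) :
    sphere X n = comb (of default) '' {l | Reduced l ∧ size l = n + 1} := by
  ext T
  have key : T ∈ sphere X n ↔ ∃ b l, Reduced (b :: l) ∧ size (b :: l) = n + 1 ∧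
      comb (of default) (b :: l) = T := by
    cases n with
    | zero =>
      rw [sphere, mem_ball_iff]
      refine exists₂_congr fun b l => and_congr_right fun _ => and_congr_left fun _ => ?_
      rw [size_cons]
      omega
    | succ n =>
      rw [sphere, Set.mem_sdiff, mem_ball_iff, mem_ball_iff]
      constructor
      · rintro ⟨⟨b, l, hl, hs, he⟩, h⟩
        refine ⟨b, l, hl, le_antisymm hs (not_lt.1 fun hlt => h ⟨b, l, hl, by omega, he⟩), he⟩
      · rintro ⟨b, l, hl, hs, he⟩
        refine ⟨⟨b, l, hl, hs.le, he⟩, ?_⟩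
        rintro ⟨c, k, hk, ht, hf⟩
        rw [comb_of_injective default hk hl (hf.trans he.symm)] at ht
        omega
  rw [key]
  constructor
  · rintro ⟨b, l, hl, hs, he⟩
    exact ⟨b :: l, ⟨hl, hs⟩, he⟩
  · rintro ⟨_ | ⟨b, l⟩, ⟨hl, hs⟩, he⟩
    · exact absurd hs (Nat.succ_ne_zero n).symm
    · exact ⟨b, l, hl, hs, he⟩

theorem injOn_comb (n : ℕ) :
    Set.InjOn (comb (of (default : X))) {l | Reduced l ∧ size l = n + 1} := by
  rintro (_ | ⟨b, l⟩) ⟨hl, hs⟩ (_ | ⟨c, k⟩) ⟨hk, ht⟩ h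
  · rfl
  · exact absurd hs (Nat.succ_ne_zero n).symm
  · exact absurd ht (Nat.succ_ne_zero n).symm
  · exact comb_of_injective default hl hk h

theorem ncard_sphere (n : ℕ) :
    (sphere X n).ncard = Fintype.card (Nat.Partition (n + 1)) := by
  rw [sphere_eq_image, (injOn_comb X n).ncard_image, ← Nat.card_coe_set_eq,
    ← Nat.card_eq_fintype_card]
  exact Nat.card_congr (reducedEquivPartition (n + 1))

theorem finite_sphere (n : ℕ) : (sphere X n).Finite := by
  rw [sphere_eq_image]
  have : Finite {l : List ℕ | Reduced l ∧ size l = n + 1} :=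
    Finite.of_equiv _ (reducedEquivPartition (n + 1)).symm
  exact Set.Finite.image _ (Set.toFinite _)

theorem finite_ball (n : ℕ) : (ball X n).Finite := by
  induction n with
  | zero => exact finite_sphere X 0
  | succ n ih => rw [ball_succ]; exact ih.union (finite_sphere X (n + 1))

theorem ncard_sphere_le_ncard_ball (n : ℕ) : (sphere X n).ncard ≤ (ball X n).ncard := by
  refine Set.ncard_le_ncard ?_ (finite_ball X n)
  cases n with
  | zero => exact subset_rfl
  | succ n => exact Set.sdiff_subset

end FLAd

/-! ### Growth of the partition function -/

/-- Each partition of `n` contributes a term `x ^ n` to the expansion of the product of the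
geometric series `∑ x ^ (j c)` over `1 ≤ j ≤ n`, where `c` is the multiplicity of the part `j`. -/
theorem card_partition_mul_pow_le (n : ℕ) {x : ℝ} (hx0 : 0 ≤ x) (hx1 : x < 1) :
    (Fintype.card (Nat.Partition n) : ℝ) * x ^ n ≤
      ∏ j ∈ Finset.Icc 1 n, (1 - x ^ j)⁻¹ := by
  classical
  let F : Nat.Partition n → ∀ j ∈ Finset.Icc 1 n, ℕ := fun p j _ => p.parts.count j
  have hle : ∀ (p : Nat.Partition n), ∀ j ∈ p.parts, j ∈ Finset.Icc 1 n := fun p j hj =>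
    Finset.mem_Icc.2 ⟨p.parts_pos hj, (Multiset.le_sum_of_mem hj).trans_eq p.parts_sum⟩
  have hF : Function.Injective F := fun p q h => by
    refine Nat.Partition.ext (Multiset.ext.2 fun j => ?_)
    by_cases hj : j ∈ Finset.Icc 1 n
    · exact congrFun (congrFun h j) hj
    · rw [Multiset.count_eq_zero_of_notMem fun h => hj (hle p j h),
        Multiset.count_eq_zero_of_notMem fun h => hj (hle q j h)]
  have hweight : ∀ p : Nat.Partition n,
      ∏ j ∈ (Finset.Icc 1 n).attach, x ^ (j.1 * F p j.1 j.2) = x ^ n := fun p => by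
    rw [Finset.prod_attach (Finset.Icc 1 n) fun j => x ^ (j * p.parts.count j),
      Finset.prod_pow_eq_pow_sum]
    congr 1
    conv_rhs => rw [← p.parts_sum]
    rw [Finset.sum_multiset_count_of_subset p.parts (Finset.Icc 1 n)
      fun j hj => hle p j (Multiset.mem_toFinset.1 hj)]
    exact Finset.sum_congr rfl fun j _ => by rw [smul_eq_mul, mul_comm]
  have hmem : ∀ p : Nat.Partition n,
      F p ∈ (Finset.Icc 1 n).pi fun _ => Finset.range (n + 1) := fun p => by
    refine Finset.mem_pi.2 fun j hj => Finset.mem_range.2 (Nat.lt_succ_of_le ?_)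
    refine (Multiset.count_le_card _ _).trans ?_
    have h1 : p.parts.card • 1 ≤ p.parts.sum :=
      Multiset.card_nsmul_le_sum fun i hi => p.parts_pos hi
    rwa [smul_eq_mul, mul_one, p.parts_sum] at h1
  calc (Fintype.card (Nat.Partition n) : ℝ) * x ^ n
      = ∑ p : Nat.Partition n, ∏ j ∈ (Finset.Icc 1 n).attach, x ^ (j.1 * F p j.1 j.2) := by
        simp only [hweight, Finset.sum_const, Finset.card_univ, nsmul_eq_mul]
    _ = ∑ f ∈ Finset.univ.image F,
          ∏ j ∈ (Finset.Icc 1 n).attach, x ^ (j.1 * f j.1 j.2) :=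
        (Finset.sum_image (g := F) (f := fun f => ∏ j ∈ (Finset.Icc 1 n).attach,
          x ^ (j.1 * f j.1 j.2)) hF.injOn).symm
    _ ≤ ∑ f ∈ (Finset.Icc 1 n).pi fun _ => Finset.range (n + 1),
          ∏ j ∈ (Finset.Icc 1 n).attach, x ^ (j.1 * f j.1 j.2) := by
        refine Finset.sum_le_sum_of_subset_of_nonneg ?_ fun f _ _ =>
          Finset.prod_nonneg fun j _ => pow_nonneg hx0 _
        exact Finset.image_subset_iff.2 fun p _ => hmem p
    _ = ∏ j ∈ Finset.Icc 1 n, ∑ c ∈ Finset.range (n + 1), x ^ (j * c) :=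
        (Finset.prod_sum (Finset.Icc 1 n) (fun _ => Finset.range (n + 1))
          fun j c => x ^ (j * c)).symm
    _ ≤ ∏ j ∈ Finset.Icc 1 n, (1 - x ^ j)⁻¹ := by
        refine Finset.prod_le_prod
          (fun j _ => Finset.sum_nonneg fun c _ => pow_nonneg hx0 _) fun j hj => ?_
        have hj1 : x ^ j < 1 := pow_lt_one₀ hx0 hx1 (by have := (Finset.mem_Icc.1 hj).1; omega)
        rw [← tsum_geometric_of_lt_one (pow_nonneg hx0 j) hj1]
        simp only [pow_mul]
        exact (summable_geometric_of_lt_one (pow_nonneg hx0 j) hj1).sum_le_tsum _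
          fun c _ => pow_nonneg (pow_nonneg hx0 j) c

/-- The bound does not depend on `n`: the `j`-th factor is at most `exp (x ^ j / (1 - x))`. -/
theorem prod_inv_one_sub_pow_le (n : ℕ) {x : ℝ} (hx0 : 0 ≤ x) (hx1 : x < 1) :
    ∏ j ∈ Finset.Icc 1 n, (1 - x ^ j)⁻¹ ≤ Real.exp ((1 - x)⁻¹ * (1 - x)⁻¹) := by
  have hx : 0 < 1 - x := sub_pos.2 hx1
  have hfac : ∀ j ∈ Finset.Icc 1 n, (1 - x ^ j)⁻¹ ≤ Real.exp (x ^ j * (1 - x)⁻¹) := by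
    intro j hj
    have hj0 : j ≠ 0 := by have := (Finset.mem_Icc.1 hj).1; omega
    have h1 : x ^ j ≤ x := pow_le_of_le_one hx0 hx1.le hj0
    have h2 : 0 < 1 - x ^ j := by linarith
    calc (1 - x ^ j)⁻¹ = x ^ j * (1 - x ^ j)⁻¹ + 1 := by field_simp; ring
      _ ≤ x ^ j * (1 - x)⁻¹ + 1 := by gcongr
      _ ≤ _ := Real.add_one_le_exp _
  calc ∏ j ∈ Finset.Icc 1 n, (1 - x ^ j)⁻¹
      ≤ ∏ j ∈ Finset.Icc 1 n, Real.exp (x ^ j * (1 - x)⁻¹) := by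
        refine Finset.prod_le_prod (fun j _ => ?_) hfac
        exact inv_nonneg.2 (sub_nonneg.2 (pow_le_one₀ hx0 hx1.le))
    _ = Real.exp ((∑ j ∈ Finset.Icc 1 n, x ^ j) * (1 - x)⁻¹) := by
        rw [← Real.exp_sum, Finset.sum_mul]
    _ ≤ _ := by
        gcongr
        rw [← tsum_geometric_of_lt_one hx0 hx1]
        exact (summable_geometric_of_lt_one hx0 hx1).sum_le_tsum _ fun c _ => pow_nonneg hx0 c

theorem exists_card_partition_le {c : ℝ} (hc : 1 < c) :
    ∃ C : ℝ, 0 ≤ C ∧ ∀ n, (Fintype.card (Nat.Partition n) : ℝ) ≤ C * c ^ n := by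
  have hc0 : 0 < c := one_pos.trans hc
  refine ⟨Real.exp ((1 - c⁻¹)⁻¹ * (1 - c⁻¹)⁻¹), (Real.exp_pos _).le, fun n => ?_⟩
  have h := (card_partition_mul_pow_le n (inv_nonneg.2 hc0.le) (inv_lt_one_of_one_lt₀ hc)).trans
    (prod_inv_one_sub_pow_le n (inv_nonneg.2 hc0.le) (inv_lt_one_of_one_lt₀ hc))
  rwa [inv_pow, ← div_eq_mul_inv, div_le_iff₀ (pow_pos hc0 n)] at h

/-- The multiplicities of the parts `2, …, r + 1` may be chosen freely below `m`, with parts `1`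
to fill up the sum. -/
theorem pow_le_card_partition {r m n : ℕ} (h : r * (m * (r + 1)) ≤ n) :
    m ^ r ≤ Fintype.card (Nat.Partition n) := by
  let s : (Fin r → Fin m) → Multiset ℕ := fun f =>
    ∑ i, Multiset.replicate (f i : ℕ) ((i : ℕ) + 2)
  have hsum : ∀ f, (s f).sum ≤ n := fun f => by
    simp only [s, Multiset.sum_sum, Multiset.sum_replicate, smul_eq_mul]
    refine (Finset.sum_le_card_nsmul _ _ (m * (r + 1)) fun i _ => ?_).trans ?_
    · exact Nat.mul_le_mul (f i).2.le (by omega)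
    · simpa using h
  have hpos : ∀ f, ∀ x ∈ s f, 0 < x := fun f x hx => by
    obtain ⟨i, -, hi⟩ := Multiset.mem_sum.1 hx
    rw [Multiset.eq_of_mem_replicate hi]
    omega
  have hcount : ∀ f (i : Fin r), (s f).count ((i : ℕ) + 2) = f i := fun f i => by
    simp only [s, Multiset.count_sum', Multiset.count_replicate]
    rw [Finset.sum_eq_single i]
    · simp
    · intro j _ hj
      exact if_neg fun h => hj (Fin.ext (by omega))
    · simp
  let F : (Fin r → Fin m) → Nat.Partition n := fun f =>
    { parts := s f + Multiset.replicate (n - (s f).sum) 1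
      parts_pos := fun {x} hx => by
        rcases Multiset.mem_add.1 hx with hx | hx
        · exact hpos f x hx
        · rw [Multiset.eq_of_mem_replicate hx]
          exact one_pos
      parts_sum := by
        have := hsum f
        simp only [Multiset.sum_add, Multiset.sum_replicate, smul_eq_mul, mul_one]
        omega }
  have hF : Function.Injective F := fun f g hfg => by
    funext i
    have hc := congrArg (fun p => Multiset.count ((i : ℕ) + 2) (Nat.Partition.parts p)) hfg
    simp only [F, Multiset.count_add, hcount, Multiset.count_replicate] at hc
    rw [if_neg (by omega), if_neg (by omega), add_zero, add_zero] at hc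
    exact Fin.ext hc
  simpa using Fintype.card_le_of_injective F hF

theorem exists_pow_le_card_partition (r : ℕ) :
    ∃ C : ℝ, 0 ≤ C ∧ ∀ n : ℕ, (n : ℝ) ^ r ≤ C * Fintype.card (Nat.Partition n) := by
  let K := r * (r + 1) + 1
  refine ⟨((2 * K : ℕ) : ℝ) ^ r, by positivity, fun n => ?_⟩
  -- `max (n / K) 1` covers the small `n`, for which `n / K = 0`.
  have hm : (max (n / K) 1) ^ r ≤ Fintype.card (Nat.Partition n) := by
    rcases le_total (n / K) 1 with h | h
    · rw [max_eq_right h, one_pow]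
      exact Fintype.card_pos
    · rw [max_eq_left h]
      refine pow_le_card_partition (le_trans ?_ (Nat.mul_div_le n K))
      calc r * (n / K * (r + 1)) = r * (r + 1) * (n / K) := by ring
        _ ≤ K * (n / K) := Nat.mul_le_mul_right _ (Nat.le_succ _)
  have hn : n ≤ 2 * K * max (n / K) 1 := by
    have h1 : n < K * (n / K + 1) := Nat.lt_mul_div_succ n (Nat.succ_pos _)
    have h2 : K * (n / K + 1) ≤ K * (2 * max (n / K) 1) := Nat.mul_le_mul_left _ (by omega)
    calc n ≤ K * (2 * max (n / K) 1) := h1.le.trans h2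
      _ = _ := by ring
  have h : n ^ r ≤ (2 * K) ^ r * Fintype.card (Nat.Partition n) :=
    (Nat.pow_le_pow_left hn r).trans (by rw [mul_pow]; exact Nat.mul_le_mul_left _ hm)
  exact_mod_cast h

/-- The strict asymptotics follow from the bounds with exponent `d + 1` in place of `d` and base
`√c` in place of `c`. -/
theorem hasIntermediateGrowth_of_bounds {f : ℕ → ℕ}
    (hlow : ∀ d : ℕ, ∃ C : ℝ, ∀ n : ℕ, (n : ℝ) ^ d ≤ C * f n)
    (hupp : ∀ c : ℝ, 1 < c → ∃ C : ℝ, ∀ n : ℕ, (f n : ℝ) ≤ C * c ^ n) :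
    HasIntermediateGrowth f := by
  constructor
  · intro d
    have hO : (fun n : ℕ => (n : ℝ) ^ (d + 1)) =O[atTop] fun n : ℕ => (f n : ℝ) := by
      obtain ⟨C, hC⟩ := hlow (d + 1)
      refine IsBigO.of_bound C (Eventually.of_forall fun n => ?_)
      rw [Real.norm_of_nonneg (by positivity), Real.norm_of_nonneg (by positivity)]
      exact hC n
    refine IsLittleO.trans_isBigO ?_ hO
    exact (isLittleO_pow_pow_atTop_of_lt d.lt_succ_self).comp_tendsto
      (tendsto_natCast_atTop_atTop (R := ℝ))
  · intro c hc
    have h1 : 1 < Real.sqrt c := by rwa [Real.lt_sqrt zero_le_one, one_pow]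
    have h2 : Real.sqrt c < c := by
      have := Real.mul_self_sqrt (zero_le_one.trans hc.le)
      nlinarith
    obtain ⟨C, hC⟩ := hupp _ h1
    refine IsBigO.trans_isLittleO (IsBigO.of_bound C (Eventually.of_forall fun n => ?_))
      (isLittleO_pow_pow_of_lt_left (Real.sqrt_nonneg c) h2)
    rw [Real.norm_of_nonneg (by positivity), Real.norm_of_nonneg (by positivity)]
    exact hC n

/-! ### Growth of the free left adequate monoid on one generator -/

namespace FLAd

variable (X : Type*) [Unique X]

theorem exists_pow_le_ncard_sphere (d : ℕ) :
    ∃ C : ℝ, 0 ≤ C ∧ ∀ n : ℕ, (n : ℝ) ^ d ≤ C * (sphere X n).ncard := by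
  obtain ⟨C, hC0, hC⟩ := exists_pow_le_card_partition d
  refine ⟨C, hC0, fun n => ?_⟩
  rw [ncard_sphere]
  exact le_trans (by gcongr; exact n.le_succ) (hC (n + 1))

theorem exists_ncard_sphere_le {c : ℝ} (hc : 1 < c) :
    ∃ C : ℝ, 0 ≤ C ∧ ∀ n, ((sphere X n).ncard : ℝ) ≤ C * c ^ n := by
  obtain ⟨C, hC0, hC⟩ := exists_card_partition_le hc
  refine ⟨C * c, by positivity, fun n => ?_⟩
  rw [ncard_sphere, mul_assoc, ← pow_succ']
  exact hC (n + 1)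

theorem exists_ncard_ball_le {c : ℝ} (hc : 1 < c) :
    ∃ C : ℝ, 0 ≤ C ∧ ∀ n, ((ball X n).ncard : ℝ) ≤ C * c ^ n := by
  obtain ⟨C, hC0, hC⟩ := exists_ncard_sphere_le X hc
  have hc0 : 0 < c - 1 := sub_pos.2 hc
  refine ⟨C * c / (c - 1), by positivity, fun n => ?_⟩
  calc ((ball X n).ncard : ℝ)
      ≤ ∑ i ∈ Finset.range (n + 1), ((sphere X i).ncard : ℝ) := by
        exact_mod_cast ncard_ball_le X n
    _ ≤ ∑ i ∈ Finset.range (n + 1), C * c ^ i := Finset.sum_le_sum fun i _ => hC i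
    _ = C * ((c ^ (n + 1) - 1) / (c - 1)) := by rw [← Finset.mul_sum, geom_sum_eq hc.ne']
    _ ≤ C * (c ^ (n + 1) / (c - 1)) := by gcongr; linarith
    _ = C * c / (c - 1) * c ^ n := by rw [pow_succ]; ring

theorem hasIntermediateGrowth_sphere :
    HasIntermediateGrowth fun n => (sphere X n).ncard :=
  hasIntermediateGrowth_of_bounds
    (fun d => (exists_pow_le_ncard_sphere X d).imp fun _ h => h.2)
    (fun _ hc => (exists_ncard_sphere_le X hc).imp fun _ h => h.2)

theorem hasIntermediateGrowth_ball :
    HasIntermediateGrowth fun n => (ball X n).ncard :=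
  hasIntermediateGrowth_of_bounds
    (fun d => by
      obtain ⟨C, hC0, hC⟩ := exists_pow_le_ncard_sphere X d
      exact ⟨C, fun n => (hC n).trans (mul_le_mul_of_nonneg_left
        (by exact_mod_cast ncard_sphere_le_ncard_ball X n) hC0)⟩)
    (fun _ hc => (exists_ncard_ball_le X hc).imp fun _ h => h.2)

end FLAd

theorem mainTheorem2 (X : Type*) [Unique X] :
    (∀ n : ℕ, (FLAd.ball X n).Finite) ∧
    (∀ n : ℕ, (FLAd.sphere X n).ncard = Fintype.card (Nat.Partition (n + 1))) ∧
    HasIntermediateGrowth (fun n => (FLAd.sphere X n).ncard) ∧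
    HasIntermediateGrowth (fun n => (FLAd.ball X n).ncard) :=
  ⟨FLAd.finite_ball X, FLAd.ncard_sphere X, FLAd.hasIntermediateGrowth_sphere X,
    FLAd.hasIntermediateGrowth_ball X⟩
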